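/- Let $\Theta$ be a Polish space with a metric inducing its topology. Call a Borel measure on $\Theta$ locally finite if it is finite on bounded sets; the space of locally finite measures carries the $\sigma$-algebra generated by the evaluations $\mu\mapsto\mu(A)$, $A$ Borel, and a random measure is a random element of this space. Let $\mathrm{BM}_+(\Theta)$ be the set of nonnegative bounded measurable functions on $\Theta$ with bounded support. For locally finite $H,M$ and $c>0$, $\mathrm{NcGaP}(H,M,c^{-1})$ (noncentral gamma process) denotes the law of a random measure $W$ with $$\mathrm{E}\big(e^{-\int f\,dW}\big)=\exp\Big(-\int_\Theta\log(1+cf)\,dH-\int_\Theta\frac{cf}{1+cf}\,dM\Big),\qquad f\in\mathrm{BM}_+(\Theta).$$ Let $H$ be a locally finite measure on $\Theta$, let $\beta_t>0$ and $c_t>0$ for $t\ge 2$, and let $(W_t)_{t\ge1}$ be an M-ARG(1) process, that is, a Markov process of random measures on $\Theta$ with arbitrary (possibly random) locally finite initial value $W_1$ such that, for every $t\ge1$, the conditional law of $W_{t+1}$ given $W_t$ is $\mathrm{NcGaP}(H,\beta_{t+1}W_t,c_{t+1}^{-1})$. For $t\ge 1$, $h\ge1$ put $\rho_j=\beta_jc_j$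 and $$\rho_{t+h|t}=\prod_{j=t+1}^{t+h}\rho_j,\qquad c_{t+h|t}=c_{t+h}+\sum_{j=t+1}^{t+h-1}c_j\prod_{i=j+1}^{t+h}\rho_i,\qquad \beta_{t+h|t}=\rho_{t+h|t}\,c_{t+h|t}^{-1}$$ (so $c_{t+1|t}=c_{t+1}$). Then, for all $t\ge1$, $h\ge1$ and $f\in\mathrm{BM}_+(\Theta)$, almost surely $$\mathrm{E}\big(e^{-\int f\,dW_{t+h}}\,\big|\,W_t\big)=\exp\Big(-\int_\Theta\log(1+c_{t+h|t}f)\,dH-\int_\Theta\frac{\rho_{t+h|t}f}{1+c_{t+h|t}f}\,dW_t\Big).$$ Moreover, the conditional law of $W_{t+h}$ given $W_t$ is $\mathrm{NcGaP}(H,\beta_{t+h|t}W_t,c_{t+h|t}^{-1})$. -/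

import Mathlib

open MeasureTheory ProbabilityTheory

noncomputable section

/-- Locally finite measures on a metric space: measures giving finite mass to every bounded set. -/
def LocFinMeasure (Θ : Type*) [MetricSpace Θ] [MeasurableSpace Θ] : Type _ :=
  {μ : Measure Θ // ∀ s : Set Θ, Bornology.IsBounded s → μ s < ⊤}

namespace LocFinMeasure

variable {Θ : Type*} [MetricSpace Θ] [MeasurableSpace Θ]

/-- The underlying measure. -/
def toMeasure (μ : LocFinMeasure Θ) : Measure Θ := μ.1

/-- The σ-algebra generated by the evaluations `μ ↦ μ s` at measurable sets `s`. -/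
instance : MeasurableSpace (LocFinMeasure Θ) :=
  MeasurableSpace.comap LocFinMeasure.toMeasure inferInstance

/-- The measure `r μ`, for a scalar `r ≥ 0`. -/
def scale (r : ℝ) (μ : LocFinMeasure Θ) : LocFinMeasure Θ :=
  ⟨ENNReal.ofReal r • μ.toMeasure, fun s hs => by
    rw [Measure.smul_apply, smul_eq_mul]
    exact ENNReal.mul_lt_top ENNReal.ofReal_lt_top (μ.2 s hs)⟩

end LocFinMeasure

/-- The class `BM₊(Θ)` of nonnegative bounded measurable functions with bounded support. -/
structure IsBMPlus {Θ : Type*} [MetricSpace Θ] [MeasurableSpace Θ] (f : Θ → ℝ) : Prop where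
  measurable : Measurable f
  nonneg : ∀ θ, 0 ≤ f θ
  bounded : ∃ C, ∀ θ, f θ ≤ C
  bounded_support : Bornology.IsBounded (Function.support f)

/-- `Q` is the law of a noncentral gamma process `NcGaP(H, M, b)`; the last parameter is a rate,
so that the scale `c` is `b⁻¹`. -/
structure IsNcGaP {Θ : Type*} [MetricSpace Θ] [MeasurableSpace Θ]
    (H M : LocFinMeasure Θ) (b : ℝ) (Q : Measure (LocFinMeasure Θ)) : Prop where
  rate_pos : 0 < b
  isProbabilityMeasure : IsProbabilityMeasure Q
  laplace : ∀ f : Θ → ℝ, IsBMPlus f →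
    ∫ μ, Real.exp (-∫ θ, f θ ∂μ.toMeasure) ∂Q =
      Real.exp (-(∫ θ, Real.log (1 + b⁻¹ * f θ) ∂H.toMeasure)
        - ∫ θ, b⁻¹ * f θ / (1 + b⁻¹ * f θ) ∂M.toMeasure)

/-- The conditional law of the random measure `Y` given the random measure `X` is
`NcGaP(H, r X, b)`: a regular conditional distribution `κ` of `Y` given `X` satisfies
`κ(μ) = NcGaP(H, r μ, b)` for almost every `μ` under the law of `X`. -/
def HasNcGaPCondLaw {Θ Ω : Type*} [MetricSpace Θ] [MeasurableSpace Θ] [MeasurableSpace Ω]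
    (P : Measure Ω) (Y X : Ω → LocFinMeasure Θ) (H : LocFinMeasure Θ) (r b : ℝ) : Prop :=
  ∃ κ : Kernel (LocFinMeasure Θ) (LocFinMeasure Θ), IsMarkovKernel κ ∧
    HasCondDistrib Y X κ P ∧
    ∀ᵐ μ ∂(P.map X), IsNcGaP H (LocFinMeasure.scale r μ) b (κ μ)

/-- `(W_t)_{t ≥ 1}` is a measure-valued autoregressive gamma process of order 1 with base measure
`H` and parameters `(β_t, c_t)_{t ≥ 2}`. Only the times `t ≥ 1` of `W` and `t ≥ 2` of `β` and `c`
matter. -/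
structure IsMARG {Θ Ω : Type*} [MetricSpace Θ] [MeasurableSpace Θ] [MeasurableSpace Ω]
    (P : Measure Ω) (H : LocFinMeasure Θ) (β c : ℕ → ℝ) (W : ℕ → Ω → LocFinMeasure Θ) :
    Prop where
  beta_pos : ∀ t, 2 ≤ t → 0 < β t
  c_pos : ∀ t, 2 ≤ t → 0 < c t
  measurable : ∀ t, 1 ≤ t → Measurable (W t)
  /-- The Markov property with respect to the past `σ(W_1, …, W_t)`. -/
  markov : ∀ t, 1 ≤ t → ∀ B : Set (LocFinMeasure Θ), MeasurableSet B →
    P⟦W (t + 1) ⁻¹' B | ⨆ s ∈ Finset.Icc 1 t, MeasurableSpace.comap (W s) inferInstance⟧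
      =ᵐ[P] P⟦W (t + 1) ⁻¹' B | MeasurableSpace.comap (W t) inferInstance⟧
  transition : ∀ t, 1 ≤ t → HasNcGaPCondLaw P (W (t + 1)) (W t) H (β (t + 1)) (c (t + 1))⁻¹

/-- `ρ_{t+h|t} = ∏_{j=t+1}^{t+h} ρ_j`, where `ρ_j = β_j c_j`. -/
def rhoLag (β c : ℕ → ℝ) (t h : ℕ) : ℝ :=
  ∏ j ∈ Finset.Icc (t + 1) (t + h), β j * c j

/-- `c_{t+h|t} = c_{t+h} + ∑_{j=t+1}^{t+h-1} c_j ∏_{i=j+1}^{t+h} ρ_i`, for `h ≥ 1`. -/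
def cLag (β c : ℕ → ℝ) (t h : ℕ) : ℝ :=
  c (t + h) + ∑ j ∈ Finset.Icc (t + 1) (t + h - 1),
    c j * ∏ i ∈ Finset.Icc (j + 1) (t + h), β i * c i

/-- `β_{t+h|t} = ρ_{t+h|t} c_{t+h|t}⁻¹`. -/
def betaLag (β c : ℕ → ℝ) (t h : ℕ) : ℝ :=
  rhoLag β c t h * (cLag β c t h)⁻¹

end

/-! The one-step Laplace functional at `f` is a constant depending on `H` times `exp (-∫ g dν)`,
where `g = βcf/(1+cf)` is again in `BM₊`. Averaging over the current state `ν` thus evaluates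
another noncentral gamma functional at `g`. Since Möbius maps compose to Möbius maps, the result has
the same form with new parameters (`IsNcGaP.comp`). The Markov property makes the composed kernel
the true multi-step conditional law (`comp_of_markov`). Induction on the lag, with the recursions
`cLag_succ` and `rhoLag_succ`, gives the law; the Laplace formula is then read off from it. -/

namespace ProbabilityTheory.HasCondDistrib

/-! ### Conditional laws and Chapman–Kolmogorov -/

variable {Ω 𝓧 𝓨 𝓩 : Type*} {mΩ : MeasurableSpace Ω} {m𝓧 : MeasurableSpace 𝓧}
  {m𝓨 : MeasurableSpace 𝓨} {m𝓩 : MeasurableSpace 𝓩} {P : Measure Ω}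
  {X : Ω → 𝓧} {Y : Ω → 𝓨} {Z : Ω → 𝓩} {κ : Kernel 𝓧 𝓨} {η : Kernel 𝓨 𝓩}

lemma integrable_snd (h : HasCondDistrib Y X κ P) {g : 𝓨 → ℝ} (hg : StronglyMeasurable g)
    (hint : Integrable (fun ω => g (Y ω)) P) :
    Integrable (fun p : 𝓧 × 𝓨 => g p.2) (P.map X ⊗ₘ κ) := by
  rw [← h.map_eq]
  exact (integrable_map_measure (hg.comp_measurable measurable_snd).aestronglyMeasurable
    h.aemeasurable).2 hint

variable [IsFiniteMeasure P] [IsMarkovKernel κ] [IsMarkovKernel η]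

/-- The law of `Y` is obtained by averaging the conditional law of `Y` given `X`. -/
lemma map_eq_comp (h : HasCondDistrib Y X κ P) : P.map Y = κ ∘ₘ P.map X := by
  rw [← Measure.snd_compProd, ← h.map_eq, Measure.snd_map_prodMk₀ h.aemeasurable_fst]

/-- Integration of a function of `Y` over an event of `σ(X)`, through the conditional law. -/
lemma setIntegral_eq (h : HasCondDistrib Y X κ P) {g : 𝓨 → ℝ} (hg : StronglyMeasurable g)
    (hint : Integrable (fun ω => g (Y ω)) P) {A : Set 𝓧} (hA : MeasurableSet A) :
    ∫ ω in X ⁻¹' A, g (Y ω) ∂P = ∫ x in A, ∫ y, g y ∂κ x ∂(P.map X) := by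
  have hg' : StronglyMeasurable (fun p : 𝓧 × 𝓨 => g p.2) := hg.comp_measurable measurable_snd
  have h1 := Measure.setIntegral_compProd hA MeasurableSet.univ (h.integrable_snd hg hint).integrableOn
  rw [← h.map_eq, setIntegral_map (hA.prod MeasurableSet.univ) hg'.aestronglyMeasurable
    h.aemeasurable] at h1
  simpa [Set.prod_univ, Set.preimage_preimage] using h1

/-- The conditional expectation of a function of `Y` given `X` is the integral of that function
against the conditional law of `Y` given `X`. -/
lemma condExp_ae_eq (h : HasCondDistrib Y X κ P) (hX : Measurable X) {g : 𝓨 → ℝ}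
    (hg : StronglyMeasurable g) (hint : Integrable (fun ω => g (Y ω)) P) :
    P[fun ω => g (Y ω) | MeasurableSpace.comap X m𝓧] =ᵐ[P] fun ω => ∫ y, g y ∂κ (X ω) := by
  have hsm : StronglyMeasurable fun x => ∫ y, g y ∂κ x := hg.integral_kernel
  have hintκ : Integrable (fun ω => ∫ y, g y ∂κ (X ω)) P :=
    (Integrable.integral_compProd (κ := Kernel.const Unit (P.map X))
      (η := Kernel.prodMkLeft Unit κ) (a := ())
      (h.integrable_snd hg hint)).comp_measurable hX
  refine (ae_eq_condExp_of_forall_setIntegral_eq hX.comap_le hint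
    (fun _ _ _ => hintκ.integrableOn) ?_ ?_).symm
  · rintro _ ⟨A, hA, rfl⟩ -
    rw [h.setIntegral_eq hg hint hA,
      setIntegral_map hA hsm.aestronglyMeasurable hX.aemeasurable]
  · exact (hsm.comp_measurable (comap_measurable X)).aestronglyMeasurable

/-- Chapman–Kolmogorov: if `Z` depends on a past containing `X` and `Y` only through `Y`, then the
conditional law of `Z` given `X` is the composition of the two one-step conditional laws. -/
lemma comp_of_markov (hYX : HasCondDistrib Y X κ P) (hZY : HasCondDistrib Z Y η P)
    (hX : Measurable X) (hY : Measurable Y) (hZ : Measurable Z) {m : MeasurableSpace Ω}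
    (hm : m ≤ mΩ) (hXm : MeasurableSpace.comap X m𝓧 ≤ m)
    (hmarkov : ∀ B : Set 𝓩, MeasurableSet B →
      P⟦Z ⁻¹' B | m⟧ =ᵐ[P] P⟦Z ⁻¹' B | MeasurableSpace.comap Y m𝓨⟧) :
    HasCondDistrib Z X (η ∘ₖ κ) P := by
  refine ⟨by fun_prop, Measure.ext_prod fun {A B} hA hB => ?_⟩
  have hind : StronglyMeasurable (B.indicator fun _ => (1 : ℝ)) :=
    stronglyMeasurable_const.indicator hB
  have hintZ : Integrable ((Z ⁻¹' B).indicator fun _ => (1 : ℝ)) P :=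
    (integrable_const _).indicator (hZ hB)
  have hηm : Measurable fun y => η y B := η.measurable_coe hB
  -- By the Markov property, conditioning on the whole past gives a function of `Y` alone. As `X ⁻¹'
  -- A` lies in that past, this function can be integrated over it.
  have hcond : P⟦Z ⁻¹' B | m⟧ =ᵐ[P] fun ω => (η (Y ω)).real B := by
    refine (hmarkov B hB).trans ((hZY.condExp_ae_eq hY hind hintZ).trans (ae_of_all _ fun ω => ?_))
    simp [integral_indicator hB]
  have hreal : P.real (X ⁻¹' A ∩ Z ⁻¹' B) = ∫ ω in X ⁻¹' A, (η (Y ω)).real B ∂P := by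
    rw [← setIntegral_congr_ae (hX hA) (hcond.mono fun ω hω _ => hω),
      setIntegral_condExp hm hintZ (hXm _ ⟨A, hA, rfl⟩), setIntegral_indicator (hZ hB)]
    simp
  have hintη : Integrable (fun ω => (η (Y ω)).real B) P :=
    Integrable.of_bound (C := 1) (hηm.comp hY).ennreal_toReal.aestronglyMeasurable
      (ae_of_all _ fun ω => by
        rw [Real.norm_of_nonneg measureReal_nonneg]
        exact measureReal_le_one)
  rw [hYX.setIntegral_eq (g := fun y => (η y).real B) hηm.ennreal_toReal.stronglyMeasurable
    hintη hA] at hreal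
  rw [Measure.map_apply (by fun_prop) (hA.prod hB), Measure.compProd_apply_prod hA hB,
    Set.mk_preimage_prod, ← ENNReal.ofReal_toReal (measure_ne_top P _)]
  change ENNReal.ofReal (P.real _) = _
  rw [hreal]
  have hk : ∀ x, ∫ y, (η y).real B ∂κ x = ((η ∘ₖ κ) x B).toReal := fun x => by
    rw [Kernel.comp_apply' _ _ _ hB]
    exact integral_toReal hηm.aemeasurable (ae_of_all _ fun y => measure_lt_top _ _)
  simp_rw [hk]
  rw [integral_toReal (Kernel.measurable_coe _ hB).aemeasurable
    (ae_of_all _ fun x => measure_lt_top _ _), ENNReal.ofReal_toReal]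
  exact ((setLIntegral_le_lintegral _ _).trans_lt
    ((lintegral_mono fun x => prob_le_one).trans_lt (by simp))).ne

end ProbabilityTheory.HasCondDistrib

/-! ### Laplace functionals and the semigroup property -/

section BMPlus

variable {Θ : Type*} [MetricSpace Θ] [MeasurableSpace Θ] {f : Θ → ℝ}

/-- A bounded measurable function with bounded support is integrable against a locally finite
measure. -/
lemma LocFinMeasure.integrable_of_bound (μ : LocFinMeasure Θ) {g : Θ → ℝ} (hg : Measurable g)
    {C : ℝ} (hC : ∀ θ, |g θ| ≤ C) (hs : Bornology.IsBounded (Function.support g)) :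
    Integrable g μ.toMeasure := by
  rw [← integrableOn_iff_integrable_of_support_subset (le_refl (Function.support g))]
  exact Measure.integrableOn_of_bounded (μ.2 _ hs).ne hg.aestronglyMeasurable
    (M := C) (ae_of_all _ hC)

lemma LocFinMeasure.measurable_toMeasure :
    Measurable (LocFinMeasure.toMeasure : LocFinMeasure Θ → Measure Θ) :=
  comap_measurable _

lemma IsBMPlus.integrable (hf : IsBMPlus f) (μ : LocFinMeasure Θ) :
    Integrable f μ.toMeasure := by
  obtain ⟨C, hC⟩ := hf.bounded
  exact μ.integrable_of_bound hf.measurable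
    (fun θ => by rw [abs_of_nonneg (hf.nonneg θ)]; exact hC θ) hf.bounded_support

lemma IsBMPlus.integrable_log (hf : IsBMPlus f) {c : ℝ} (hc : 0 ≤ c) (μ : LocFinMeasure Θ) :
    Integrable (fun θ => Real.log (1 + c * f θ)) μ.toMeasure := by
  have hm := hf.measurable
  refine ((hf.integrable μ).const_mul c).mono'
    (Real.measurable_log.comp (measurable_const.add (hm.const_mul c))).aestronglyMeasurable (ae_of_all _ fun θ => ?_)
  have h0 : 0 ≤ c * f θ := mul_nonneg hc (hf.nonneg θ)
  rw [Real.norm_of_nonneg (Real.log_nonneg (by linarith))]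
  linarith [Real.log_le_sub_one_of_pos (show 0 < 1 + c * f θ by linarith)]

/-- The class `BM₊` is stable under the Möbius maps `f ↦ r f / (1 + c f)`. -/
lemma IsBMPlus.mul_div_one_add (hf : IsBMPlus f) {r c : ℝ} (hr : 0 ≤ r) (hc : 0 ≤ c) :
    IsBMPlus fun θ => r * f θ / (1 + c * f θ) where
  measurable := by
    have hm := hf.measurable
    fun_prop
  nonneg θ := by
    have := hf.nonneg θ
    positivity
  bounded := by
    obtain ⟨C, hC⟩ := hf.bounded
    refine ⟨r * C, fun θ => ?_⟩
    have h0 := hf.nonneg θ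
    exact (div_le_self (by positivity) (le_add_of_nonneg_right (by positivity))).trans
      (mul_le_mul_of_nonneg_left (hC θ) hr)
  bounded_support := hf.bounded_support.subset fun θ hθ h0 => hθ (by simp [h0])

lemma IsBMPlus.measurable_exp_neg_integral (hf : IsBMPlus f) :
    Measurable fun μ : LocFinMeasure Θ => Real.exp (-∫ θ, f θ ∂μ.toMeasure) := by
  have h1 : ∀ μ : LocFinMeasure Θ, ∫ θ, f θ ∂μ.toMeasure
      = (∫⁻ θ, ENNReal.ofReal (f θ) ∂μ.toMeasure).toReal := fun μ =>
    integral_eq_lintegral_of_nonneg_ae (ae_of_all _ hf.nonneg) hf.measurable.aestronglyMeasurable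
  simp_rw [h1]
  exact (((Measure.measurable_lintegral hf.measurable.ennreal_ofReal).comp
    LocFinMeasure.measurable_toMeasure).ennreal_toReal.neg).exp

lemma IsBMPlus.norm_exp_neg_integral_le (hf : IsBMPlus f) (μ : LocFinMeasure Θ) :
    ‖Real.exp (-∫ θ, f θ ∂μ.toMeasure)‖ ≤ 1 := by
  rw [Real.norm_of_nonneg (Real.exp_nonneg _), Real.exp_le_one_iff, neg_nonpos]
  exact integral_nonneg hf.nonneg

lemma LocFinMeasure.integral_scale {r : ℝ} (hr : 0 ≤ r) (μ : LocFinMeasure Θ) (g : Θ → ℝ) :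
    ∫ θ, g θ ∂(μ.scale r).toMeasure = ∫ θ, r * g θ ∂μ.toMeasure := by
  change ∫ θ, g θ ∂(ENNReal.ofReal r • μ.toMeasure) = _
  rw [integral_smul_measure, ENNReal.toReal_ofReal hr, integral_const_mul, smul_eq_mul]

/-- The noncentral gamma transition laws form a semigroup: mixing `NcGaP(H, β ν, c⁻¹)` over
`ν ∼ NcGaP(H, γ μ, d⁻¹)` gives `NcGaP(H, δ μ, e⁻¹)` with `e = c + β c d` and `δ e = β c γ d`. -/
lemma IsNcGaP.comp {H μ : LocFinMeasure Θ} {β c γ d δ e : ℝ} (hβ : 0 ≤ β) (hc : 0 < c)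
    (hγ : 0 ≤ γ) (hd : 0 < d) (hδ : 0 ≤ δ) (he : e = c + β * c * d)
    (hδe : δ * e = β * c * (γ * d))
    {κ η : Kernel (LocFinMeasure Θ) (LocFinMeasure Θ)} [IsMarkovKernel κ] [IsMarkovKernel η]
    (hκ : IsNcGaP H (μ.scale γ) d⁻¹ (κ μ))
    (hη : ∀ᵐ ν ∂κ μ, IsNcGaP H (ν.scale β) c⁻¹ (η ν)) :
    IsNcGaP H (μ.scale δ) e⁻¹ ((η ∘ₖ κ) μ) where
  rate_pos := by rw [he]; positivity
  isProbabilityMeasure := inferInstance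
  laplace f hf := by
    have hg : IsBMPlus fun θ => β * c * f θ / (1 + c * f θ) :=
      hf.mul_div_one_add (by positivity) hc.le
    have hinner : ∀ᵐ ν ∂κ μ, ∫ ξ, Real.exp (-∫ θ, f θ ∂ξ.toMeasure) ∂η ν
        = Real.exp (-∫ θ, Real.log (1 + c * f θ) ∂H.toMeasure)
          * Real.exp (-∫ θ, β * c * f θ / (1 + c * f θ) ∂ν.toMeasure) := by
      filter_upwards [hη] with ν hν
      rw [hν.laplace f hf, LocFinMeasure.integral_scale hβ, inv_inv, ← Real.exp_add, sub_eq_add_neg]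
      simp only [mul_div_assoc, mul_assoc]
    rw [Kernel.integral_comp (Integrable.of_bound
        hf.measurable_exp_neg_integral.aestronglyMeasurable 1
        (ae_of_all _ hf.norm_exp_neg_integral_le)),
      integral_congr_ae hinner, integral_const_mul, hκ.laplace _ hg,
      LocFinMeasure.integral_scale hγ, LocFinMeasure.integral_scale hδ, ← Real.exp_add,
      inv_inv, inv_inv, sub_eq_add_neg, sub_eq_add_neg, ← add_assoc, ← neg_add,
      ← integral_add (hf.integrable_log hc.le H) (hg.integrable_log hd.le H)]
    have hpos : ∀ θ, 0 < 1 + c * f θ := fun θ => by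
      have := hf.nonneg θ
      positivity
    have hpos' : ∀ θ, 0 < 1 + e * f θ := fun θ => by
      have := hf.nonneg θ
      rw [he]
      positivity
    -- With `g = βcf/(1+cf)`, clearing denominators in `1 + d g` forces `e = c + βcd`.
    have hfac : ∀ θ, 1 + d * (β * c * f θ / (1 + c * f θ)) = (1 + e * f θ) / (1 + c * f θ) :=
      fun θ => by
        have := (hpos θ).ne'
        rw [he]
        field_simp
        ring
    -- Under `H` the terms `log (1 + c f)` cancel; under `μ` the denominators `1 + c f` do, leaving
    -- `δe = βcγd`.
    congr 4
    · funext θ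
      rw [hfac, Real.log_div (hpos' θ).ne' (hpos θ).ne']
      ring
    · funext θ
      have h1 := (hpos θ).ne'
      have h2 := (hpos' θ).ne'
      rw [hfac]
      have h3 : δ * (e * f θ / (1 + e * f θ)) = (δ * e) * f θ / (1 + e * f θ) := by ring
      rw [h3, hδe]
      field_simp

end BMPlus

/-! ### Recursions for the lagged parameters -/

section Lag

variable {β c : ℕ → ℝ} {t : ℕ}

lemma rhoLag_one : rhoLag β c t 1 = β (t + 1) * c (t + 1) := by
  simp [rhoLag]

lemma cLag_one : cLag β c t 1 = c (t + 1) := by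
  simp [cLag]

lemma rhoLag_succ (h : ℕ) :
    rhoLag β c t (h + 1) = rhoLag β c t h * (β (t + (h + 1)) * c (t + (h + 1))) := by
  rw [rhoLag, ← add_assoc, Finset.prod_Icc_succ_top (by omega), rhoLag]

/-- Each product gains the last factor `ρ`, and the former leading term `c (t + h)` becomes the top
summand, with a one-factor product. -/
lemma cLag_succ {h : ℕ} (hh : 1 ≤ h) :
    cLag β c t (h + 1)
      = c (t + (h + 1)) + β (t + (h + 1)) * c (t + (h + 1)) * cLag β c t h := by
  -- Removes the truncated subtraction in the upper limit `t + h - 1`.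
  obtain ⟨k, rfl⟩ := Nat.exists_eq_add_of_le' hh
  have hprod : ∀ j ∈ Finset.Icc (t + 1) (t + k),
      c j * ∏ i ∈ Finset.Icc (j + 1) (t + k + 1 + 1), β i * c i
        = β (t + k + 1 + 1) * c (t + k + 1 + 1)
          * (c j * ∏ i ∈ Finset.Icc (j + 1) (t + k + 1), β i * c i) := fun j hj => by
    rw [Finset.prod_Icc_succ_top (by have := (Finset.mem_Icc.1 hj).2; omega)]
    ring
  simp only [cLag, ← add_assoc, Nat.add_sub_cancel]
  rw [Finset.sum_Icc_succ_top (by omega), Finset.sum_congr rfl hprod, ← Finset.mul_sum]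
  simp only [Finset.Icc_self, Finset.prod_singleton]
  ring

lemma rhoLag_pos (hβ : ∀ t, 2 ≤ t → 0 < β t) (hc : ∀ t, 2 ≤ t → 0 < c t) (ht : 1 ≤ t) (h : ℕ) :
    0 < rhoLag β c t h :=
  Finset.prod_pos fun j hj => by
    have := (Finset.mem_Icc.1 hj).1
    exact mul_pos (hβ j (by omega)) (hc j (by omega))

lemma cLag_pos (hβ : ∀ t, 2 ≤ t → 0 < β t) (hc : ∀ t, 2 ≤ t → 0 < c t) (ht : 1 ≤ t) {h : ℕ}
    (hh : 1 ≤ h) : 0 < cLag β c t h := by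
  refine add_pos_of_pos_of_nonneg (hc _ (by omega)) (Finset.sum_nonneg fun j hj => ?_)
  have hj1 := (Finset.mem_Icc.1 hj).1
  refine mul_nonneg (hc j (by omega)).le (Finset.prod_nonneg fun i hi => ?_)
  have hi1 := (Finset.mem_Icc.1 hi).1
  exact (mul_pos (hβ i (by omega)) (hc i (by omega))).le

lemma betaLag_mul_cLag (hβ : ∀ t, 2 ≤ t → 0 < β t) (hc : ∀ t, 2 ≤ t → 0 < c t) (ht : 1 ≤ t)
    {h : ℕ} (hh : 1 ≤ h) : betaLag β c t h * cLag β c t h = rhoLag β c t h :=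
  inv_mul_cancel_right₀ (cLag_pos hβ hc ht hh).ne' _

lemma betaLag_pos (hβ : ∀ t, 2 ≤ t → 0 < β t) (hc : ∀ t, 2 ≤ t → 0 < c t) (ht : 1 ≤ t) {h : ℕ}
    (hh : 1 ≤ h) : 0 < betaLag β c t h :=
  mul_pos (rhoLag_pos hβ hc ht h) (inv_pos.2 (cLag_pos hβ hc ht hh))

end Lag

/-- The `h`-step transition law of a measure-valued autoregressive gamma process. -/
lemma IsMARG.hasNcGaPCondLaw {Θ Ω : Type*} [MetricSpace Θ] [MeasurableSpace Θ]
    [MeasurableSpace Ω] {P : Measure Ω} [IsProbabilityMeasure P] {H : LocFinMeasure Θ}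
    {β c : ℕ → ℝ} {W : ℕ → Ω → LocFinMeasure Θ} (hW : IsMARG P H β c W) {t h : ℕ} (ht : 1 ≤ t)
    (hh : 1 ≤ h) :
    HasNcGaPCondLaw P (W (t + h)) (W t) H (betaLag β c t h) (cLag β c t h)⁻¹ := by
  induction h, hh using Nat.le_induction with
  | base =>
    have hb : betaLag β c t 1 = β (t + 1) := by
      rw [betaLag, rhoLag_one, cLag_one, mul_inv_cancel_right₀ (hW.c_pos _ (by omega)).ne']
    rw [hb, cLag_one]
    exact hW.transition t ht
  | succ h hh ih =>
    obtain ⟨κ, hκM, hκ, hκlaw⟩ := ih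
    obtain ⟨η, hηM, hη, hηlaw⟩ := hW.transition (t + h) (by omega)
    have hβ := hW.beta_pos
    have hc := hW.c_pos
    have hh' : 1 ≤ h + 1 := by omega
    refine ⟨η ∘ₖ κ, inferInstance, ?_, ?_⟩
    · refine hκ.comp_of_markov hη (hW.measurable t ht) (hW.measurable _ (by omega))
        (hW.measurable _ (by omega)) (iSup₂_le fun s hs => ?_) ?_ (hW.markov (t + h) (by omega))
      · exact (hW.measurable s (Finset.mem_Icc.1 hs).1).comap_le
      · exact le_iSup₂_of_le t (Finset.mem_Icc.2 ⟨ht, by omega⟩) le_rfl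
    -- The one-step law is known for almost every value of `W (t + h)`. That variable's law is a
    -- mixture of the `κ μ`, so for almost every `μ` it holds `κ μ`-almost everywhere.
    · rw [hκ.map_eq_comp] at hηlaw
      filter_upwards [hκlaw, Measure.ae_ae_of_ae_comp hηlaw] with μ h1 h2
      refine IsNcGaP.comp (hβ _ (by omega)).le (hc _ (by omega)) (betaLag_pos hβ hc ht hh).le
        (cLag_pos hβ hc ht hh) (betaLag_pos hβ hc ht hh').le (cLag_succ hh) ?_ h1 h2
      rw [betaLag_mul_cLag hβ hc ht hh', betaLag_mul_cLag hβ hc ht hh, rhoLag_succ, mul_comm]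

theorem proposition4 {Θ Ω : Type*} [MetricSpace Θ] [PolishSpace Θ] [MeasurableSpace Θ]
    [BorelSpace Θ] [MeasurableSpace Ω] (P : Measure Ω) [IsProbabilityMeasure P]
    (H : LocFinMeasure Θ) (β c : ℕ → ℝ) (W : ℕ → Ω → LocFinMeasure Θ)
    (hW : IsMARG P H β c W) (t h : ℕ) (ht : 1 ≤ t) (hh : 1 ≤ h) :
    (∀ f : Θ → ℝ, IsBMPlus f →
      P[fun ω => Real.exp (-∫ θ, f θ ∂(W (t + h) ω).toMeasure) |
          MeasurableSpace.comap (W t) inferInstance]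
        =ᵐ[P] fun ω =>
          Real.exp (-(∫ θ, Real.log (1 + cLag β c t h * f θ) ∂H.toMeasure)
            - ∫ θ, rhoLag β c t h * f θ / (1 + cLag β c t h * f θ) ∂(W t ω).toMeasure)) ∧
    HasNcGaPCondLaw P (W (t + h)) (W t) H (betaLag β c t h) (cLag β c t h)⁻¹ := by
  have hlaw := hW.hasNcGaPCondLaw ht hh
  refine ⟨fun f hf => ?_, hlaw⟩
  obtain ⟨κ, hκM, hκ, hκlaw⟩ := hlaw
  have hexp := hf.measurable_exp_neg_integral
  have hcond := hκ.condExp_ae_eq (hW.measurable t ht) hexp.stronglyMeasurable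
    (Integrable.of_bound (C := 1)
      (hexp.comp (hW.measurable (t + h) (by omega))).aestronglyMeasurable
      (ae_of_all _ fun ω => hf.norm_exp_neg_integral_le _))
  filter_upwards [hcond, ae_of_ae_map (hW.measurable t ht).aemeasurable hκlaw] with ω h1 h2
  have hb : ∀ x, betaLag β c t h * (cLag β c t h * x / (1 + cLag β c t h * x))
      = rhoLag β c t h * x / (1 + cLag β c t h * x) := fun x => by
    rw [← mul_div_assoc, ← mul_assoc, betaLag_mul_cLag hW.beta_pos hW.c_pos ht hh]
  rw [h1, h2.laplace f hf,
    LocFinMeasure.integral_scale (betaLag_pos hW.beta_pos hW.c_pos ht hh).le, inv_inv]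
  simp only [hb]
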